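/- Let $K$ be a field and let $X\subseteq\mathbb A^n_K$ be an integral affine surface over $K$, i.e. the zero locus of a prime ideal $I\subset K[X_1,\dots,X_n]$ whose coordinate ring $K[X]=K[X_1,\dots,X_n]/I$ has Krull dimension $2$. Let $\overline X\subseteq\mathbb P^n_K$ be its projective closure (the Zariski closure of $X$ under the embedding $(x_1,\dots,x_n)\mapsto[1:x_1:\cdots:x_n]$, with its reduced structure), and let $X_\infty=\overline X\setminus X$ be the set of points at infinity. For an integral domain $D$ with quotient field $Q(D)$, let $R(D)$ be the subring of $Q(D)$ generated by the elements $1/d$ with $d\in D\setminus\{0\}$. Suppose that $X_\infty$ is irreducible and contains a nonsingular point of $\overline X$, i.e. a point at which the local ring of $\overline X$ is a regular local ring. Then: (a) if $K$ is algebraically closed in $K[X]$ (every element of $K[X]$ that is algebraic over $K$ lies in $K$), then $K[X]\cap R(K[X])=K$, the intersection being taken in $Q(K[X])$; (b) $\dim R(K[X])\geq 1$. -/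

import Mathlib

open MvPolynomial

noncomputable section

attribute [local instance] MvPolynomial.gradedAlgebra

/-- The reciprocal complement of an integral domain `D`: the subring of the quotient field of `D`
generated by the inverses of the nonzero elements of `D`. -/
def reciprocalComplement (D : Type*) [CommRing D] [IsDomain D] : Subring (FractionRing D) :=
  Subring.closure {y | ∃ d : D, d ≠ 0 ∧ y = (algebraMap D (FractionRing D) d)⁻¹}

/-- The standard grading by degree on `K[X₀, …, Xₙ]`. -/
abbrev projGrading (K : Type*) [Field K] (n : ℕ) :
    ℕ → Submodule K (MvPolynomial (Fin (n + 1)) K) :=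
  MvPolynomial.homogeneousSubmodule (Fin (n + 1)) K

/-- The projective space of dimension `n` over `K`, with its Zariski topology: the homogeneous
prime ideals of `K[X₀, …, Xₙ]` not containing `(X₀, …, Xₙ)`. -/
abbrev ProjSpace (K : Type*) [Field K] (n : ℕ) : Type _ :=
  ProjectiveSpectrum (projGrading K n)

/-- Dehomogenization `F(X₀, …, Xₙ) ↦ F(1, X₁, …, Xₙ)`; the affine variables are indexed by
`Fin n`, the homogenization variable is the variable with index `0`. -/
def dehomogenize (K : Type*) [Field K] (n : ℕ) :
    MvPolynomial (Fin (n + 1)) K →ₐ[K] MvPolynomial (Fin n) K :=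
  MvPolynomial.aeval (Fin.cons 1 MvPolynomial.X)

/-- The standard embedding `(x₁, …, xₙ) ↦ [1 : x₁ : ⋯ : xₙ]` of the affine space into the projective
space. On prime ideals: `p` goes to the ideal generated by the homogeneous `F` whose
dehomogenization lies in `p`. -/
def affineToProj (K : Type*) [Field K] (n : ℕ) (p : PrimeSpectrum (MvPolynomial (Fin n) K)) :
    ProjSpace K n where
  asHomogeneousIdeal :=
    (p.asIdeal.comap (dehomogenize K n)).homogeneousCore (projGrading K n)
  isPrime := (Ideal.IsPrime.comap (dehomogenize K n)).homogeneousCore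
  not_irrelevant_le := by
    intro h
    have h0 : (X 0 : MvPolynomial (Fin (n + 1)) K) ∈ HomogeneousIdeal.irrelevant (projGrading K n) := by
      rw [HomogeneousIdeal.mem_irrelevant_iff, GradedRing.proj_apply]
      exact DirectSum.decompose_of_mem_ne _ (isHomogeneous_X K (0 : Fin (n + 1))) one_ne_zero
    have h1 := Ideal.toIdeal_homogeneousCore_le (projGrading K n)
      (p.asIdeal.comap (dehomogenize K n)) (h h0)
    rw [Ideal.mem_comap] at h1
    have h2 : dehomogenize K n (X 0) = 1 := by simp [dehomogenize]
    rw [h2] at h1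
    exact p.isPrime.ne_top ((Ideal.eq_top_iff_one _).mpr h1)

/-- The affine variety defined by the ideal `I`, as a subset of the projective space. -/
def affineLocus {K : Type*} [Field K] {n : ℕ} (I : Ideal (MvPolynomial (Fin n) K)) :
    Set (ProjSpace K n) :=
  affineToProj K n '' PrimeSpectrum.zeroLocus (I : Set (MvPolynomial (Fin n) K))

/-- The projective closure of the affine variety defined by `I`. -/
def projClosure {K : Type*} [Field K] {n : ℕ} (I : Ideal (MvPolynomial (Fin n) K)) :
    Set (ProjSpace K n) :=
  closure (affineLocus I)

/-- The set of points at infinity of the affine variety defined by `I`. -/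
def pointsAtInfinity {K : Type*} [Field K] {n : ℕ} (I : Ideal (MvPolynomial (Fin n) K)) :
    Set (ProjSpace K n) :=
  projClosure I \ affineLocus I

/-- The local ring at the point `p` of the projective space: the quotients `F / G` of homogeneous
polynomials of the same degree with `G ∉ p`. -/
abbrev projLocalRing {K : Type*} [Field K] {n : ℕ} (p : ProjSpace K n) : Type _ :=
  HomogeneousLocalization.AtPrime (projGrading K n) p.asHomogeneousIdeal.toIdeal

/-- The ideal of a set `Z` in the local ring of the projective space at `p`: the germs `F / G` that
lie in the extension of the vanishing ideal of `Z`. -/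
def idealAt {K : Type*} [Field K] {n : ℕ} (Z : Set (ProjSpace K n)) (p : ProjSpace K n) :
    Ideal (projLocalRing p) :=
  ((ProjectiveSpectrum.vanishingIdeal Z).toIdeal.map
    (algebraMap (MvPolynomial (Fin (n + 1)) K)
      (Localization.AtPrime p.asHomogeneousIdeal.toIdeal))).comap
    (algebraMap (projLocalRing p) (Localization.AtPrime p.asHomogeneousIdeal.toIdeal))

/-- `p` is a nonsingular point of the closed set `Z`, taken with its reduced structure: it lies on
`Z` and the local ring of `Z` at `p` is a regular local ring. -/
def IsNonsingularPoint {K : Type*} [Field K] {n : ℕ} (Z : Set (ProjSpace K n))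
    (p : ProjSpace K n) : Prop :=
  p ∈ Z ∧ IsRegularLocalRing (projLocalRing p ⧸ idealAt Z p)

end

/-!
Let `V` be the local ring of `X̄` along `X_∞`, a subring of the function field of `X`.

* At a nonsingular point of `X_∞`, the local ring of `X̄` is regular of dimension at most two, so
  the height-one prime defining `X_∞` there is principal. Splitting off the powers of its generator
  shows that `V` is a valuation ring.
* A function `d ∈ K[X] ∩ V` is integral over `K`: let `S ⊆ K[X][T]` be the homogeneous coordinate
  ring of `X̄`, in which `T = 0` is the equation of the hyperplane at infinity. At every prime of
  height one of `S`, the function `d` is a fraction with a denominator outside the prime: a power of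
  `T` if `T` does not belong to the prime; otherwise the prime is the ideal of `X_∞`, and `d ∈ V`
  provides the denominator. Hence `d` is integral over `S`, and setting `T = 0` shows that it is
  integral over `K`.
* Consequently `1 / d ∈ V` for all nonzero `d ∈ K[X]`, that is, `R(K[X]) ⊆ V`, and `K[X] ∩ V`
  consists of algebraic elements. On the other hand, some coordinate function has a pole along
  `X_∞`, so `K[X]` is not contained in `R(K[X])`.
-/

universe u v

section TranscendenceDegree

variable {K : Type v} [Field K] {A B : Type u} [CommRing A] [CommRing B]
  [Algebra K A] [Algebra K B]

theorem trdeg_add_one_le_of_surjective_of_not_injective [IsDomain A] [IsDomain B]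
    (hfin : Algebra.trdeg K A < Cardinal.aleph0) (f : A →ₐ[K] B) (hf : Function.Surjective f)
    (hinj : ¬ Function.Injective f) : Algebra.trdeg K B + 1 ≤ Algebra.trdeg K A := by
  refine Cardinal.add_one_le_of_lt (lt_of_not_ge fun hle => hinj ?_)
  have : FaithfulSMul K B :=
    (faithfulSMul_iff_algebraMap_injective _ _).mpr (algebraMap K B).injective
  obtain ⟨s, hs⟩ := exists_isTranscendenceBasis K B
  choose x hx using fun y : s => hf y
  have hfx : f ∘ x = Subtype.val := funext hx
  have hx := AlgebraicIndependent.of_comp f (hfx ▸ hs.1)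
  have hbasis := hx.isTranscendenceBasis_of_trdeg_le hfin (hs.cardinalMk_eq_trdeg ▸ hle)
  have := hbasis.isAlgebraic
  rw [injective_iff_map_eq_zero]
  by_contra! ⟨a, hfa, ha⟩
  obtain ⟨⟨b, hb⟩, hfb, hb0⟩ := (Submodule.ne_bot_iff _).mp
    (Ideal.comap_ne_bot_of_algebraic_mem (I := RingHom.ker f) ha hfa
      (this.isAlgebraic (R := Algebra.adjoin K (Set.range x)) a))
  rw [Algebra.adjoin_range_eq_range_aeval] at hb
  obtain ⟨g, rfl⟩ := hb
  have hg : aeval (Subtype.val : s → B) g = 0 := by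
    rw [← hfx]
    exact (comp_aeval_apply (f := x) f g).symm.trans hfb
  have hg0 : g = 0 := hs.1 (by rw [hg, map_zero])
  exact hb0 (Subtype.ext (by simp [hg0]))

theorem trdeg_quotient_add_one_le_of_lt (hfin : Algebra.trdeg K A < Cardinal.aleph0)
    {P Q : Ideal A} [P.IsPrime] [Q.IsPrime] (h : P < Q) :
    Algebra.trdeg K (A ⧸ Q) + 1 ≤ Algebra.trdeg K (A ⧸ P) := by
  refine trdeg_add_one_le_of_surjective_of_not_injective
    ((trdeg_le_of_surjective _ (Ideal.Quotient.mkₐ_surjective K P)).trans_lt hfin)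
    (Ideal.Quotient.factorₐ K h.le) (Ideal.Quotient.factor_surjective h.le) fun hinj => ?_
  obtain ⟨x, hxQ, hxP⟩ := SetLike.exists_of_lt h
  refine hxP (Ideal.Quotient.eq_zero_iff_mem.mp (hinj ?_))
  rw [map_zero]
  exact Ideal.Quotient.eq_zero_iff_mem.mpr hxQ

theorem ringKrullDim_le_of_trdeg_le {s : ℕ} (hs : Algebra.trdeg K A ≤ s) : ringKrullDim A ≤ s := by
  have hchain (l : LTSeries (PrimeSpectrum A)) (P : PrimeSpectrum A) (hP : l.last = P) :
      Algebra.trdeg K (A ⧸ P.asIdeal) + l.length ≤ Algebra.trdeg K A := by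
    induction l using RelSeries.inductionOn' generalizing P with
    | singleton Q =>
      simpa using trdeg_le_of_surjective _ (Ideal.Quotient.mkₐ_surjective K P.asIdeal)
    | snoc l Q hlQ ih =>
      obtain rfl : Q = P := (RelSeries.last_snoc l Q hlQ).symm.trans hP
      have hlt : l.last.asIdeal < Q.asIdeal := hlQ
      calc Algebra.trdeg K (A ⧸ Q.asIdeal) + ((l.snoc Q hlQ).length : ℕ)
          = Algebra.trdeg K (A ⧸ Q.asIdeal) + 1 + l.length := by
            rw [RelSeries.snoc_length, Nat.cast_succ, add_right_comm, add_assoc]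
        _ ≤ Algebra.trdeg K (A ⧸ l.last.asIdeal) + l.length := by
            gcongr
            exact trdeg_quotient_add_one_le_of_lt (hs.trans_lt Cardinal.natCast_lt_aleph0) hlt
        _ ≤ Algebra.trdeg K A := ih l.last rfl
  refine iSup_le fun l => ?_
  exact_mod_cast (le_add_self.trans (hchain l l.last rfl)).trans hs

end TranscendenceDegree

section MvPolynomialQuotient

variable {K σ : Type*} [Field K] {f : MvPolynomial σ K} {i : σ}

theorem eq_zero_of_rename_mem_span_singleton (hi : i ∈ f.vars) {g : MvPolynomial {j // j ≠ i} K}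
    (hg : rename Subtype.val g ∈ Ideal.span {f}) : g = 0 := by
  classical
  obtain ⟨c, hc⟩ := Ideal.mem_span_singleton.mp hg
  by_contra h0
  have hr : rename (Subtype.val : {j // j ≠ i} → σ) g ≠ 0 := by
    rwa [Ne, map_eq_zero_iff _ (rename_injective _ Subtype.val_injective)]
  have hdeg (p : MvPolynomial σ K) : i ∈ p.vars ↔ degreeOf i p ≠ 0 := by
    rw [degreeOf, Multiset.count_ne_zero, vars_def, Multiset.mem_toFinset]
  have hvars : i ∉ (rename (Subtype.val : {j // j ≠ i} → σ) g).vars := fun h => by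
    obtain ⟨j, -, hj⟩ := Finset.mem_image.mp (vars_rename _ _ h)
    exact j.2 hj
  rw [hdeg, not_not, hc, degreeOf_mul_eq (left_ne_zero_of_mul (hc ▸ hr))
    (right_ne_zero_of_mul (hc ▸ hr))] at hvars
  exact (hdeg f).mp hi (Nat.eq_zero_of_add_eq_zero_right hvars)

theorem algebraicIndependent_X_quotient_span_singleton (hi : i ∈ f.vars) :
    AlgebraicIndependent K
      fun j : {j // j ≠ i} => Ideal.Quotient.mkₐ K (Ideal.span {f}) (X j.1) := by
  rw [algebraicIndependent_iff]
  intro g hg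
  refine eq_zero_of_rename_mem_span_singleton hi (Ideal.Quotient.eq_zero_iff_mem.mp ?_)
  rw [← hg]
  change ((Ideal.Quotient.mkₐ K _).comp (rename Subtype.val)) g = _
  congr 1
  ext j
  simp

theorem card_le_trdeg_quotient_span_singleton_add_one {s : ℕ} {f : MvPolynomial (Fin s) K}
    (hf : f.vars.Nonempty) :
    (s : Cardinal) ≤ Algebra.trdeg K (MvPolynomial (Fin s) K ⧸ Ideal.span {f}) + 1 := by
  obtain ⟨i, hi⟩ := hf
  have := (algebraicIndependent_X_quotient_span_singleton hi).lift_cardinalMk_le_trdeg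
  obtain ⟨s, rfl⟩ : ∃ s', s = s' + 1 := ⟨s - 1, by have := i.2; omega⟩
  push_cast
  gcongr
  simpa using this

end MvPolynomialQuotient

theorem eq_bot_of_lt_of_height_le_one {A : Type*} [CommRing A] [IsDomain A] {P Q : Ideal A}
    [P.IsPrime] (hP : P.height ≤ 1) (hQ : Q.IsPrime) (hQP : Q < P) : Q = ⊥ := by
  rw [← Ideal.height_eq_zero_iff_eq_bot]
  exact Order.lt_one_iff.mp (Ideal.height_le_iff (n := 1).mp hP Q hQ hQP)

theorem under_eq_span_singleton_of_height_le_one {B A : Type*} [CommRing B] [CommRing A]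
    [IsDomain A] [Algebra B A] [Algebra.HasGoingDown B A] [FaithfulSMul B A]
    (P : Ideal A) [P.IsPrime] (hP : P.height ≤ 1) {f : B} (hf : Prime f)
    (hfP : algebraMap B A f ∈ P) : P.under B = Ideal.span {f} := by
  have := (Ideal.span_singleton_prime hf.ne_zero).mpr hf
  by_contra hne
  obtain ⟨Q, hQ, hQp, hQf⟩ := Ideal.exists_ideal_lt_liesOver_of_lt (q := P.under B) P
    (lt_of_le_of_ne ((Ideal.span_singleton_le_iff_mem _).mpr hfP) (Ne.symm hne))
  obtain rfl := eq_bot_of_lt_of_height_le_one hP hQp hQ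
  have hf0 : f ∈ (⊥ : Ideal A).under B := hQf.over ▸ Ideal.mem_span_singleton_self f
  rw [Ideal.under_def, Ideal.mem_comap, Ideal.mem_bot] at hf0
  exact hf.ne_zero (FaithfulSMul.algebraMap_injective B A (by rw [hf0, map_zero]))

section NoetherNormalization

theorem exists_isIntegral_algebra_mvPolynomial (K A : Type u) [Field K] [CommRing A] [Nontrivial A]
    [Algebra K A] [Algebra.FiniteType K A] :
    ∃ (s : ℕ) (_ : Algebra (MvPolynomial (Fin s) K) A),
      IsScalarTower K (MvPolynomial (Fin s) K) A ∧ FaithfulSMul (MvPolynomial (Fin s) K) A ∧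
        Algebra.IsIntegral (MvPolynomial (Fin s) K) A := by
  obtain ⟨s, g, hg, hi⟩ := exists_integral_inj_algHom_of_fg K A
  algebraize [g.toRingHom]
  exact ⟨s, inferInstance, .of_algebraMap_eq fun x => (g.commutes x).symm,
    (faithfulSMul_iff_algebraMap_injective _ _).mpr hg, ⟨hi⟩⟩

variable {K A : Type u} [Field K] [CommRing A] [IsDomain A] [Algebra K A]

theorem trdeg_eq_of_isIntegral_mvPolynomial (s : ℕ) [Algebra (MvPolynomial (Fin s) K) A]
    [IsScalarTower K (MvPolynomial (Fin s) K) A] [FaithfulSMul (MvPolynomial (Fin s) K) A]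
    [Algebra.IsIntegral (MvPolynomial (Fin s) K) A] : Algebra.trdeg K A = s := by
  rw [← trdeg_add_eq K (MvPolynomial (Fin s) K) (A := A), MvPolynomial.trdeg_of_isDomain]
  simp [trdeg_eq_zero]

variable [Algebra.FiniteType K A]

theorem trdeg_le_of_ringKrullDim_le {d : ℕ} (hd : ringKrullDim A ≤ d) : Algebra.trdeg K A ≤ d := by
  obtain ⟨s, _, _, _, _⟩ := exists_isIntegral_algebra_mvPolynomial K A
  suffices hs : ringKrullDim (MvPolynomial (Fin s) K) ≤ ringKrullDim A by
    rw [trdeg_eq_of_isIntegral_mvPolynomial s]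
    rw [ringKrullDim_of_isNoetherianRing] at hs
    exact_mod_cast (show (s : WithBot ℕ∞) ≤ d by simpa using hs.trans hd)
  refine iSup_le fun l => ?_
  obtain ⟨P, hP⟩ := Algebra.IsIntegral.comap_surjective (MvPolynomial (Fin s) K) A l.head
  have : P.asIdeal.LiesOver l.head.asIdeal := ⟨by rw [← hP]; rfl⟩
  obtain ⟨l', hl', -⟩ := Ideal.exists_ltSeries_of_hasGoingUp l P.asIdeal
  exact hl' ▸ Order.LTSeries.length_le_krullDim l'

theorem trdeg_le_trdeg_quotient_add_one {P : Ideal A} [P.IsPrime] (hP0 : P ≠ ⊥)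
    (hP : P.height ≤ 1) : Algebra.trdeg K A ≤ Algebra.trdeg K (A ⧸ P) + 1 := by
  obtain ⟨s, _, _, _, _⟩ := exists_isIntegral_algebra_mvPolynomial K A
  obtain ⟨f, hfP, hf⟩ := Ideal.IsPrime.exists_mem_prime_of_ne_bot
    (inferInstanceAs (P.under (MvPolynomial (Fin s) K)).IsPrime)
    (Ideal.IsIntegral.comap_ne_bot (MvPolynomial (Fin s) K) hP0)
  have hvars : f.vars.Nonempty := by
    rw [Finset.nonempty_iff_ne_empty, Ne, vars_eq_empty_iff_eq_C]
    intro hC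
    refine hf.not_isUnit (hC ▸ (isUnit_iff_ne_zero.mpr fun h0 => hf.ne_zero ?_).map C)
    rw [hC, h0, map_zero]
  calc Algebra.trdeg K A = s := trdeg_eq_of_isIntegral_mvPolynomial s
    _ ≤ Algebra.trdeg K (MvPolynomial (Fin s) K ⧸ P.under (MvPolynomial (Fin s) K)) + 1 := by
      rw [under_eq_span_singleton_of_height_le_one P hP hf hfP]
      exact card_le_trdeg_quotient_span_singleton_add_one hvars
    _ ≤ Algebra.trdeg K (A ⧸ P) + 1 := by
      gcongr
      exact trdeg_le_of_injective (IsScalarTower.toAlgHom K _ (A ⧸ P))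
        Ideal.algebraMap_quotient_injective

end NoetherNormalization

section Hartogs

theorem isIntegral_of_isUnit_inv {S L : Type*} [CommRing S] [Nontrivial S] [Field L] [Algebra S L]
    {d : L} (hd : d ≠ 0)
    (h : IsUnit (⟨d⁻¹, Algebra.self_mem_adjoin_singleton S d⁻¹⟩ : Algebra.adjoin S {d⁻¹})) :
    IsIntegral S d := by
  let := invertibleOfNonzero (inv_ne_zero hd)
  obtain ⟨p, hp, hpd⟩ := Algebra.exists_aeval_invOf_eq_zero_of_idealMap_adjoin_sup_span_eq_top d⁻¹
    (⊥ : Ideal S) bot_ne_top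
    (top_unique <| (Ideal.span_singleton_eq_top.mpr h).ge.trans le_sup_right)
  rw [invOf_eq_inv, inv_inv] at hpd
  exact ⟨p, sub_eq_zero.mp hp, hpd⟩

theorem algebraMap_quotient_adjoin_surjective {S L : Type*} [CommRing S] [CommRing L] [Algebra S L]
    {x : L} {P : Ideal (Algebra.adjoin S {x})}
    (hP : ⟨x, Algebra.self_mem_adjoin_singleton S x⟩ ∈ P) :
    Function.Surjective (algebraMap S (Algebra.adjoin S {x} ⧸ P)) := by
  suffices h : (⊤ : Subalgebra S (Algebra.adjoin S {x})) ≤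
      Subalgebra.comap (Ideal.Quotient.mkₐ S P) ⊥ by
    intro y
    obtain ⟨z, rfl⟩ := Ideal.Quotient.mk_surjective y
    exact Algebra.mem_bot.mp (h (Algebra.mem_top (x := z)))
  rw [← Algebra.adjoin_adjoin_coe_preimage, Algebra.adjoin_le_iff]
  intro z hz
  have hzP : Ideal.Quotient.mkₐ S P z = 0 :=
    Ideal.Quotient.eq_zero_iff_mem.mpr ((Subtype.ext hz : z = ⟨x, _⟩) ▸ hP)
  rw [SetLike.mem_coe, Subalgebra.mem_comap, hzP]
  exact Subalgebra.zero_mem _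

variable (K : Type u) {S L : Type u} [Field K] [CommRing S] [IsDomain S] [Algebra K S]
  [Algebra.FiniteType K S]

theorem trdeg_quotient_add_two_le {P : Ideal S} [P.IsPrime] (hP : ¬ P.height ≤ 1) :
    Algebra.trdeg K (S ⧸ P) + 1 + 1 ≤ Algebra.trdeg K S := by
  have hfin : Algebra.trdeg K S < Cardinal.aleph0 := trdeg_lt_aleph0_of_finiteType
  obtain ⟨Q, _, hQP, hQ⟩ : ∃ Q : Ideal S, Q.IsPrime ∧ Q < P ∧ ⊥ < Q := by
    contrapose! hP
    refine Ideal.height_le_iff (n := 1).mpr fun Q hQ hQP => ?_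
    rw [not_bot_lt_iff.mp (hP Q hQ hQP), Ideal.height_bot]
    exact one_pos
  calc Algebra.trdeg K (S ⧸ P) + 1 + 1 ≤ Algebra.trdeg K (S ⧸ Q) + 1 := by
        gcongr
        exact trdeg_quotient_add_one_le_of_lt hfin hQP
    _ ≤ Algebra.trdeg K (S ⧸ (⊥ : Ideal S)) := trdeg_quotient_add_one_le_of_lt hfin hQ
    _ ≤ Algebra.trdeg K S := trdeg_le_of_surjective _ (Ideal.Quotient.mkₐ_surjective K _)

theorem trdeg_le_trdeg_quotient_under_add_one [Field L] [Algebra S L] [FaithfulSMul S L] {x : L}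
    (hx : x ≠ 0) {P : Ideal (Algebra.adjoin S {x})}
    (hP : P ∈ (Ideal.span {⟨x, Algebra.self_mem_adjoin_singleton S x⟩}).minimalPrimes) :
    Algebra.trdeg K S ≤ Algebra.trdeg K (S ⧸ P.under S) + 1 := by
  have : P.IsPrime := hP.1.1
  have hxP : ⟨x, Algebra.self_mem_adjoin_singleton S x⟩ ∈ P :=
    hP.1.2 (Ideal.mem_span_singleton_self _)
  let : Algebra K L := ((algebraMap S L).comp (algebraMap K S)).toAlgebra
  have : IsScalarTower K S L := .of_algebraMap_eq fun _ => rfl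
  let A := Algebra.adjoin S {x}
  have : Algebra.FiniteType K A :=
    .trans (S := S) ‹_› (A.fg_iff_finiteType.mp ⟨{x}, by simp [A]⟩)
  have : IsNoetherianRing A := Algebra.FiniteType.isNoetherianRing K A
  have hP0 : P ≠ ⊥ := by
    rintro rfl
    exact hx (congrArg Subtype.val (Ideal.mem_bot.mp hxP))
  calc Algebra.trdeg K S ≤ Algebra.trdeg K A :=
        trdeg_le_of_injective (IsScalarTower.toAlgHom K S A)
          (FaithfulSMul.algebraMap_injective S A)
    _ ≤ Algebra.trdeg K (A ⧸ P) + 1 := trdeg_le_trdeg_quotient_add_one hP0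
        (Ideal.height_le_one_of_isPrincipal_of_mem_minimalPrimes _ P hP)
    _ ≤ Algebra.trdeg K (S ⧸ P.under S) + 1 := by
        gcongr
        exact trdeg_le_of_surjective (IsScalarTower.toAlgHom K (S ⧸ P.under S) (A ⧸ P)) fun y =>
          (algebraMap_quotient_adjoin_surjective hxP y).imp' (Ideal.Quotient.mk _) fun _ h => h

include K in
theorem isIntegral_of_forall_height_le_one [Field L] [Algebra S L] [FaithfulSMul S L] {d : L}
    (hd : ∀ P : Ideal S, P.IsPrime → P.height ≤ 1 →
      ∃ b ∉ P, ∃ a, d * algebraMap S L b = algebraMap S L a) : IsIntegral S d := by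
  -- Otherwise `d⁻¹` is not a unit in `S[d⁻¹]`. A minimal prime over `d⁻¹` then contracts to a prime
  -- of `S` of height at most one, and `d` is not a fraction there.
  by_contra hint
  have hd0 : d ≠ 0 := by
    rintro rfl
    exact hint isIntegral_zero
  obtain ⟨P, hP⟩ := Set.nonempty_coe_sort.mp <| Ideal.nonempty_minimalPrimes fun h =>
    hint (isIntegral_of_isUnit_inv hd0 (Ideal.span_singleton_eq_top.mp h))
  have : P.IsPrime := hP.1.1
  have hht : ¬ (P.under S).height ≤ 1 := fun hht => by
    obtain ⟨b, hb, a, hab⟩ := hd _ inferInstance hht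
    have hba : algebraMap S (Algebra.adjoin S {d⁻¹}) b =
        ⟨d⁻¹, Algebra.self_mem_adjoin_singleton S d⁻¹⟩ * algebraMap S _ a := Subtype.ext <| by
      change algebraMap S L b = d⁻¹ * algebraMap S L a
      rw [← hab, inv_mul_cancel_left₀ hd0]
    exact hb (Ideal.mem_comap.mpr
      (hba ▸ P.mul_mem_right _ (hP.1.2 (Ideal.mem_span_singleton_self _))))
  obtain ⟨s, hs⟩ := Cardinal.lt_aleph0.mp (trdeg_lt_aleph0_of_finiteType (R := K) (S := S))
  have hle := trdeg_le_trdeg_quotient_under_add_one K (inv_ne_zero hd0) hP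
  have hlt := (add_le_add_left hle 1).trans (trdeg_quotient_add_two_le K hht)
  rw [hs] at hlt
  exact absurd (by exact_mod_cast hlt) (Nat.not_succ_le_self s)

end Hartogs

section LocalRing

open IsLocalRing

variable {R : Type*} [CommRing R]

theorem isPrincipal_of_spanFinrank_le_one {M : Type*} [AddCommGroup M] [Module R M]
    {p : Submodule R M} (hp : p.FG) (h : p.spanFinrank ≤ 1) : p.IsPrincipal := by
  rcases Nat.le_one_iff_eq_zero_or_eq_one.mp h with h0 | h1
  · rw [(Submodule.spanFinrank_eq_zero_iff_eq_bot hp).mp h0]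
    exact bot_isPrincipal
  · exact ((Submodule.spanFinrank_eq_one_iff p).mp h1).1

theorem spanFinrank_map_quotient_span_singleton_add_one_le {s : Finset R} {a : R} (ha : a ∈ s) :
    ((Ideal.span (s : Set R)).map (Ideal.Quotient.mk (Ideal.span {a}))).spanFinrank + 1 ≤
      s.card := by
  classical
  have ha0 : Ideal.Quotient.mk (Ideal.span {a}) a = 0 :=
    Ideal.Quotient.eq_zero_iff_mem.mpr (Ideal.mem_span_singleton_self a)
  rw [← Finset.insert_erase ha, Finset.coe_insert, Ideal.map_span, Set.image_insert_eq, ha0,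
    Ideal.span_insert_zero, Finset.insert_erase ha, ← Finset.card_erase_add_one ha]
  gcongr
  refine (Submodule.spanFinrank_span_le_ncard_of_finite ((s.erase a).finite_toSet.image _)).trans ?_
  exact (Set.ncard_image_le (s.erase a).finite_toSet).trans (Set.ncard_coe_finset _).le

variable [IsLocalRing R] [IsNoetherianRing R]

theorem isPrincipal_of_isPrincipal_map_quotient_span_singleton {q : Ideal R} [q.IsPrime] {a : R}
    (ham : a ∈ maximalIdeal R) (haq : a ∉ q)
    (h : (q.map (Ideal.Quotient.mk (Ideal.span {a}))).IsPrincipal) : q.IsPrincipal := by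
  obtain ⟨f', hf'⟩ := h
  obtain ⟨f, hfq, rfl⟩ := (Ideal.mem_map_iff_of_surjective _ Ideal.Quotient.mk_surjective).mp
    (hf' ▸ Submodule.mem_span_singleton_self f')
  refine ⟨f, le_antisymm ?_ ((Ideal.span_singleton_le_iff_mem _).mpr hfq)⟩
  refine Submodule.le_of_le_smul_of_le_jacobson_bot (I := Ideal.span {a})
    (IsNoetherian.noetherian q) (((Ideal.span_singleton_le_iff_mem _).mpr ham).trans
      (maximalIdeal_le_jacobson _)) fun x hx => ?_
  obtain ⟨y', hy'⟩ := Ideal.mem_span_singleton.mp (hf' ▸ Ideal.mem_map_of_mem _ hx)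
  obtain ⟨y, rfl⟩ := Ideal.Quotient.mk_surjective y'
  rw [← map_mul, Ideal.Quotient.mk_eq_mk_iff_sub_mem] at hy'
  obtain ⟨z, hz⟩ := Ideal.mem_span_singleton.mp hy'
  have hzq : z ∈ q :=
    (Ideal.IsPrime.mem_or_mem ‹_› (hz ▸ q.sub_mem hx (q.mul_mem_right _ hfq))).resolve_left haq
  rw [eq_add_of_sub_eq' hz]
  exact Submodule.add_mem_sup (Ideal.mem_span_singleton.mpr (dvd_mul_right _ _))
    (Submodule.smul_mem_smul (Ideal.mem_span_singleton_self a) hzq)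

theorem isPrincipalIdealRing_of_isPrincipal_maximalIdeal (h : (maximalIdeal R).IsPrincipal) :
    IsPrincipalIdealRing R := by
  refine IsPrincipalIdealRing.of_prime fun P hP => ?_
  by_cases hPm : P = maximalIdeal R
  · rwa [hPm]
  obtain ⟨b, hb⟩ := h
  have hbP : b ∉ P := fun hbP => hPm <| le_antisymm (le_maximalIdeal hP.ne_top) <| by
    rw [hb]
    exact (Ideal.span_singleton_le_iff_mem _).mpr hbP
  refine isPrincipal_of_isPrincipal_map_quotient_span_singleton
    (hb ▸ Ideal.mem_span_singleton_self b) hbP ?_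
  rw [(Ideal.map_eq_bot_iff_le_ker (Ideal.Quotient.mk (Ideal.span {b}))).mpr
    ((le_maximalIdeal hP.ne_top).trans (hb.trans_le (Ideal.mk_ker).ge))]
  exact bot_isPrincipal

theorem isPrincipal_of_spanFinrank_maximalIdeal_le_two
    (h2 : (maximalIdeal R).spanFinrank ≤ 2) {q : Ideal R} [q.IsPrime] (hqm : q ≠ maximalIdeal R) :
    q.IsPrincipal := by
  -- Modulo a generator `a ∉ q` of the maximal ideal, the maximal ideal is principal, hence so is
  -- the image of `q`. As `a ∉ q`, a generator of this image lifts to one of `q` by Nakayama.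
  obtain ⟨s, hcard, (hs : Ideal.span (s : Set R) = maximalIdeal R)⟩ :=
    Submodule.FG.exists_span_finset_card_eq_spanFinrank (IsNoetherian.noetherian (maximalIdeal R))
  obtain ⟨a, has, haq⟩ : ∃ a ∈ s, a ∉ q := by
    by_contra! h
    exact hqm (le_antisymm (le_maximalIdeal Ideal.IsPrime.ne_top') (hs ▸ Submodule.span_le.mpr h))
  have ham : a ∈ maximalIdeal R := hs ▸ Submodule.subset_span has
  have : Nontrivial (R ⧸ Ideal.span {a}) :=
    Ideal.Quotient.nontrivial_iff.mpr fun h => ham (Ideal.span_singleton_eq_top.mp h)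
  have : IsLocalRing (R ⧸ Ideal.span {a}) :=
    .of_surjective' (Ideal.Quotient.mk _) Ideal.Quotient.mk_surjective
  have hrank : (maximalIdeal (R ⧸ Ideal.span {a})).spanFinrank ≤ 1 := by
    have hle := spanFinrank_map_quotient_span_singleton_add_one_le has
    rw [hs, hcard, map_maximalIdeal_of_surjective _ Ideal.Quotient.mk_surjective] at hle
    exact Nat.le_of_succ_le_succ (hle.trans h2)
  have := isPrincipalIdealRing_of_isPrincipal_maximalIdeal
    (isPrincipal_of_spanFinrank_le_one (IsNoetherian.noetherian _) hrank)
  exact isPrincipal_of_isPrincipal_map_quotient_span_singleton ham haq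
    (IsPrincipalIdealRing.principal _)

theorem isPrincipal_of_height_le_one_of_ringKrullDim_le_two {R : Type*} [CommRing R]
    [IsRegularLocalRing R] (hdim : ringKrullDim R ≤ 2) {q : Ideal R} [q.IsPrime]
    (hq : q.height ≤ 1) : q.IsPrincipal := by
  have hreg := (isRegularLocalRing_iff R).mp inferInstance
  by_cases hqm : q = maximalIdeal R
  · subst hqm
    rw [← maximalIdeal_height_eq_ringKrullDim] at hreg
    refine isPrincipal_of_spanFinrank_le_one (IsNoetherian.noetherian _) ?_
    exact_mod_cast (WithBot.coe_le_coe.mp hreg.le).trans hq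
  · exact isPrincipal_of_spanFinrank_maximalIdeal_le_two
      (by exact_mod_cast hreg.trans_le hdim) hqm

end LocalRing

theorem exists_not_dvd_mul_eq_mul {R : Type*} [CommRing R] [IsDomain R] [IsNoetherianRing R] {f : R}
    (hf : Prime f) {a b : R} (ha : a ≠ 0) (hb : b ≠ 0) :
    ∃ e s, ¬ f ∣ s ∧ (a * e = b * s ∨ b * e = a * s) := by
  obtain ⟨m, a, hfa, rfl⟩ := WfDvdMonoid.max_power_factor ha hf.irreducible
  obtain ⟨l, b, hfb, rfl⟩ := WfDvdMonoid.max_power_factor hb hf.irreducible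
  rcases Nat.le_total m l with h | h <;> obtain ⟨k, rfl⟩ := Nat.exists_eq_add_of_le h
  · exact ⟨f ^ k * b, a, hfa, .inl (by ring)⟩
  · exact ⟨f ^ k * a, b, hfb, .inr (by ring)⟩

theorem mem_or_inv_mem_of_prime {K L : Type*} [Field K] [Field L] [Algebra K L]
    {R V : Subalgebra K L} [IsNoetherianRing R] (hRV : R ≤ V) {f : R} (hf : Prime f)
    (hfV : ∀ s, ¬ f ∣ s → (s : L)⁻¹ ∈ V) {z : L} {a b : R} (hb : b ≠ 0) (hz : z * b = a) :
    z ∈ V ∨ z⁻¹ ∈ V := by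
  rcases eq_or_ne a 0 with rfl | ha
  · left
    rw [(mul_eq_zero_iff_right (Subtype.coe_injective.ne hb)).mp hz]
    exact V.zero_mem
  have ha' : (a : L) ≠ 0 := Subtype.coe_injective.ne ha
  have hb' : (b : L) ≠ 0 := Subtype.coe_injective.ne hb
  obtain ⟨e, s, hs, h | h⟩ := exists_not_dvd_mul_eq_mul hf ha hb <;>
    replace h := congrArg Subtype.val h <;>
    have hs' : (s : L) ≠ 0 := (fun h0 => hs ((Subtype.ext h0 : s = 0) ▸ dvd_zero f)) <;>
    rw [eq_div_of_mul_eq hb' hz]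
  · right
    rw [inv_div, (div_eq_div_iff ha' hs').mpr (h.symm.trans (mul_comm _ _)), div_eq_mul_inv]
    exact V.mul_mem (hRV e.2) (hfV s hs)
  · left
    rw [(div_eq_div_iff hb' hs').mpr (h.symm.trans (mul_comm _ _)), div_eq_mul_inv]
    exact V.mul_mem (hRV e.2) (hfV s hs)

attribute [local instance] MvPolynomial.gradedAlgebra

section Homogeneous

variable {K : Type*} [Field K] {n : ℕ}

theorem map_eq_pow_mul_of_isHomogeneous {R S σ : Type*} [CommSemiring R] [CommSemiring S]
    [Algebra R S] {f g : MvPolynomial σ R →ₐ[R] S} {c : S} (hfg : ∀ i, f (X i) = c * g (X i))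
    {F : MvPolynomial σ R} {e : ℕ} (hF : F.IsHomogeneous e) : f F = c ^ e * g F := by
  rw [aeval_unique f, aeval_unique g, aeval_def, aeval_def, eval₂_eq, eval₂_eq, Finset.mul_sum]
  refine Finset.sum_congr rfl fun d hd => ?_
  have hdeg : ∑ i ∈ d.support, d i = e := by
    simpa only [Finsupp.weight_apply, Finsupp.sum, Pi.one_apply, smul_eq_mul, mul_one]
      using hF (mem_support_iff.mp hd)
  simp only [Function.comp_apply, hfg, mul_pow, Finset.prod_mul_distrib,
    Finset.prod_pow_eq_pow_sum, hdeg]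
  ring

theorem toIdeal_le_of_forall_isHomogeneous {J : HomogeneousIdeal (projGrading K n)}
    {P : Ideal (MvPolynomial (Fin (n + 1)) K)}
    (h : ∀ e, ∀ F ∈ J.toIdeal, F.IsHomogeneous e → F ∈ P) : J.toIdeal ≤ P := fun F hF => by
  rw [← sum_homogeneousComponent F]
  exact P.sum_mem fun i _ => h i _ (homogeneousComponent_mem_of_mem J.isHomogeneous hF i)
    (homogeneousComponent_isHomogeneous i F)

theorem proj_zero_eq_C_coeff_zero (F : MvPolynomial (Fin (n + 1)) K) :
    GradedRing.proj (projGrading K n) 0 F = C (coeff 0 F) :=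
  (decomposition.decompose'_apply F 0).trans (homogeneousComponent_zero F)

theorem le_irrelevant_of_ne_top {J : HomogeneousIdeal (projGrading K n)} (hJ : J.toIdeal ≠ ⊤) :
    J ≤ HomogeneousIdeal.irrelevant (projGrading K n) := by
  intro F hF
  rw [HomogeneousIdeal.mem_irrelevant_iff, proj_zero_eq_C_coeff_zero]
  by_contra hne
  have hmem : C (coeff 0 F) ∈ J.toIdeal :=
    homogeneousComponent_zero F ▸ homogeneousComponent_mem_of_mem J.isHomogeneous hF 0
  exact hJ (Ideal.eq_top_of_isUnit_mem _ hmem ((isUnit_iff_ne_zero.mpr (C_ne_zero.mp hne)).map C))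

theorem exists_X_notMem (p : ProjSpace K n) : ∃ i, X i ∉ p.asHomogeneousIdeal.toIdeal := by
  by_contra! h
  have hle : idealOfVars (Fin (n + 1)) K ≤ p.asHomogeneousIdeal.toIdeal :=
    Ideal.span_le.mpr (Set.range_subset_iff.mpr h)
  refine p.not_irrelevant_le fun F hF => hle ?_
  rw [HomogeneousIdeal.mem_irrelevant_iff, proj_zero_eq_C_coeff_zero, C_eq_zero] at hF
  rw [← pow_one (idealOfVars _ _), mem_pow_idealOfVars_iff']
  intro m hm
  rwa [(Finsupp.degree_eq_zero_iff m).mp (Nat.lt_one_iff.mp hm)]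

theorem dehomogenize_X_zero : dehomogenize K n (X 0) = 1 := by simp [dehomogenize]

theorem dehomogenize_X_succ (i : Fin n) : dehomogenize K n (X i.succ) = X i := by
  simp [dehomogenize]

theorem exists_isHomogeneous_dehomogenize_eq (G : MvPolynomial (Fin n) K) :
    ∃ e, ∃ F : MvPolynomial (Fin (n + 1)) K, F.IsHomogeneous e ∧ dehomogenize K n F = G := by
  induction G using MvPolynomial.induction_on with
  | C a => exact ⟨0, C a, isHomogeneous_C _ a, algHom_C _ a⟩
  | add G₁ G₂ h₁ h₂ =>
    obtain ⟨k₁, F₁, hF₁, rfl⟩ := h₁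
    obtain ⟨k₂, F₂, hF₂, rfl⟩ := h₂
    refine ⟨k₁ + k₂, F₁ * X 0 ^ k₂ + F₂ * X 0 ^ k₁, ?_, ?_⟩
    · refine (hF₁.mul (isHomogeneous_X_pow _ _)).add ?_
      exact add_comm k₁ k₂ ▸ hF₂.mul (isHomogeneous_X_pow _ _)
    · simp only [map_add, map_mul, map_pow, dehomogenize_X_zero, one_pow, mul_one]
  | mul_X G i h =>
    obtain ⟨k, F, hF, rfl⟩ := h
    exact ⟨k + 1, F * X i.succ, hF.mul (isHomogeneous_X _ _), by rw [map_mul, dehomogenize_X_succ]⟩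

end Homogeneous

section ProjectiveClosure

variable {K : Type*} [Field K] {n : ℕ} (I : Ideal (MvPolynomial (Fin n) K))

/-- The homogenization of `I`, that is, the homogeneous ideal of the projective closure of the
affine variety defined by `I`. -/
noncomputable def homogenization : HomogeneousIdeal (projGrading K n) :=
  (I.comap (dehomogenize K n)).homogeneousCore (projGrading K n)

/-- The homogeneous ideal of the set of points at infinity. -/
noncomputable def idealAtInfinity : HomogeneousIdeal (projGrading K n) :=
  ProjectiveSpectrum.vanishingIdeal (pointsAtInfinity I)

variable {I}

theorem dehomogenize_mem_of_mem_homogenization {F : MvPolynomial (Fin (n + 1)) K}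
    (hF : F ∈ (homogenization I).toIdeal) : dehomogenize K n F ∈ I :=
  Ideal.toIdeal_homogeneousCore_le _ (I.comap (dehomogenize K n)) hF

theorem mem_homogenization_iff_of_isHomogeneous {F : MvPolynomial (Fin (n + 1)) K} {e : ℕ}
    (hF : F.IsHomogeneous e) : F ∈ (homogenization I).toIdeal ↔ dehomogenize K n F ∈ I :=
  ⟨dehomogenize_mem_of_mem_homogenization, fun h =>
    Ideal.mem_homogeneousCore_of_homogeneous_of_mem ⟨e, hF⟩ h⟩

theorem X_zero_notMem_of_mem_affineLocus {p : ProjSpace K n} (hp : p ∈ affineLocus I) :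
    X 0 ∉ p.asHomogeneousIdeal.toIdeal := by
  obtain ⟨P, -, rfl⟩ := hp
  intro h
  have h1 : dehomogenize K n (X 0) ∈ P.asIdeal := dehomogenize_mem_of_mem_homogenization h
  exact P.isPrime.ne_top ((Ideal.eq_top_iff_one _).mpr (dehomogenize_X_zero (K := K) ▸ h1))

theorem exists_dehomogenize_mem_iff {P : Ideal (MvPolynomial (Fin (n + 1)) K)} [P.IsPrime]
    (h0 : X 0 ∉ P) : ∃ P' : Ideal (MvPolynomial (Fin n) K), P'.IsPrime ∧
      ∀ e, ∀ F : MvPolynomial (Fin (n + 1)) K, F.IsHomogeneous e →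
        (dehomogenize K n F ∈ P' ↔ F ∈ P) := by
  let A := MvPolynomial (Fin (n + 1)) K ⧸ P
  let ι : MvPolynomial (Fin (n + 1)) K →ₐ[K] FractionRing A :=
    (IsScalarTower.toAlgHom K A (FractionRing A)).comp (Ideal.Quotient.mkₐ K P)
  have hι : ∀ F, ι F = 0 ↔ F ∈ P := fun F =>
    (map_eq_zero_iff _ (IsFractionRing.injective A (FractionRing A))).trans
      Ideal.Quotient.eq_zero_iff_mem
  have hι0 : ι (X 0) ≠ 0 := fun h => h0 ((hι _).mp h)
  let φ : MvPolynomial (Fin n) K →ₐ[K] FractionRing A := aeval fun i => ι (X i.succ) / ι (X 0)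
  have hφ : ∀ i, ι (X i) = ι (X 0) * φ.comp (dehomogenize K n) (X i) := by
    refine Fin.cases ?_ fun i => ?_
    · rw [φ.comp_apply, dehomogenize_X_zero, map_one, mul_one]
    · rw [φ.comp_apply, dehomogenize_X_succ, aeval_X, mul_div_cancel₀ _ hι0]
  refine ⟨RingHom.ker φ, RingHom.ker_isPrime φ, fun e F hF => ?_⟩
  rw [← hι, map_eq_pow_mul_of_isHomogeneous hφ hF, mul_eq_zero_iff_left (pow_ne_zero e hι0)]
  rfl

theorem mem_affineLocus_of_X_zero_notMem {p : ProjSpace K n}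
    (hp : (homogenization I).toIdeal ≤ p.asHomogeneousIdeal.toIdeal)
    (h0 : X 0 ∉ p.asHomogeneousIdeal.toIdeal) : p ∈ affineLocus I := by
  obtain ⟨P, hP, hmem⟩ := exists_dehomogenize_mem_iff h0
  refine ⟨⟨P, hP⟩, (PrimeSpectrum.mem_zeroLocus _ _).mpr fun G hG => ?_, ?_⟩
  · obtain ⟨e, F, hF, rfl⟩ := exists_isHomogeneous_dehomogenize_eq G
    exact (hmem e F hF).mpr (hp ((mem_homogenization_iff_of_isHomogeneous hF).mpr hG))
  · refine ProjectiveSpectrum.ext (HomogeneousIdeal.ext (le_antisymm ?_ ?_))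
    · exact toIdeal_le_of_forall_isHomogeneous fun e F hF hFe =>
        (hmem e F hFe).mp (dehomogenize_mem_of_mem_homogenization hF)
    · exact toIdeal_le_of_forall_isHomogeneous fun e F hF hFe =>
        (mem_homogenization_iff_of_isHomogeneous hFe).mpr ((hmem e F hFe).mpr hF)

theorem idealAtInfinity_le_of_mem {p : ProjSpace K n} (hp : p ∈ pointsAtInfinity I) :
    (idealAtInfinity I).toIdeal ≤ p.asHomogeneousIdeal.toIdeal := fun _ hF =>
  (ProjectiveSpectrum.mem_vanishingIdeal _ _).mp hF p hp

variable [I.IsPrime]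

instance homogenization_isPrime : (homogenization I).toIdeal.IsPrime :=
  (Ideal.IsPrime.comap (dehomogenize K n)).homogeneousCore

theorem vanishingIdeal_projClosure :
    ProjectiveSpectrum.vanishingIdeal (projClosure I) = homogenization I := by
  rw [projClosure, ProjectiveSpectrum.vanishingIdeal_closure]
  refine le_antisymm (fun F hF => ?_) fun F hF => ?_
  · exact (ProjectiveSpectrum.mem_vanishingIdeal _ _).mp hF _
      ⟨⟨I, inferInstance⟩, (PrimeSpectrum.mem_zeroLocus _ _).mpr le_rfl, rfl⟩
  · refine (ProjectiveSpectrum.mem_vanishingIdeal _ _).mpr ?_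
    rintro _ ⟨p, hp, rfl⟩
    exact Ideal.homogeneousCore_mono _ (Ideal.comap_mono (f := dehomogenize K n) hp) hF

theorem mem_projClosure_iff {p : ProjSpace K n} :
    p ∈ projClosure I ↔ (homogenization I).toIdeal ≤ p.asHomogeneousIdeal.toIdeal := by
  rw [← vanishingIdeal_projClosure, projClosure, ProjectiveSpectrum.vanishingIdeal_closure,
    ← ProjectiveSpectrum.zeroLocus_vanishingIdeal_eq_closure]
  rfl

theorem mem_pointsAtInfinity_iff {p : ProjSpace K n} :
    p ∈ pointsAtInfinity I ↔ (homogenization I).toIdeal ≤ p.asHomogeneousIdeal.toIdeal ∧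
      X 0 ∈ p.asHomogeneousIdeal.toIdeal := by
  refine ⟨fun h => ?_, fun h =>
    ⟨mem_projClosure_iff.mpr h.1, fun h' => X_zero_notMem_of_mem_affineLocus h' h.2⟩⟩
  have hle := mem_projClosure_iff.mp h.1
  exact ⟨hle, not_not.mp fun h0 => h.2 (mem_affineLocus_of_X_zero_notMem hle h0)⟩

theorem homogenization_le_idealAtInfinity :
    (homogenization I).toIdeal ≤ (idealAtInfinity I).toIdeal := fun _ hF =>
  (ProjectiveSpectrum.mem_vanishingIdeal _ _).mpr fun _ hp => (mem_pointsAtInfinity_iff.mp hp).1 hF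

theorem X_zero_mem_idealAtInfinity : X 0 ∈ (idealAtInfinity I).toIdeal :=
  (ProjectiveSpectrum.mem_vanishingIdeal _ _).mpr fun _ hp => (mem_pointsAtInfinity_iff.mp hp).2

theorem vanishingIdeal_isPrime_of_isIrreducible {Z : Set (ProjSpace K n)} (hZ : IsIrreducible Z) :
    (ProjectiveSpectrum.vanishingIdeal Z).toIdeal.IsPrime := by
  obtain ⟨⟨p, hp⟩, hZ⟩ := hZ
  rw [isPreirreducible_iff_isClosed_union_isClosed] at hZ
  refine ⟨fun h => p.isPrime.ne_top ?_, fun {F G} hFG => ?_⟩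
  · rw [Ideal.eq_top_iff_one] at h ⊢
    exact (ProjectiveSpectrum.mem_vanishingIdeal _ _).mp h p hp
  · have hmem : ∀ H : MvPolynomial (Fin (n + 1)) K, Z ⊆ ProjectiveSpectrum.zeroLocus _ {H} →
        H ∈ (ProjectiveSpectrum.vanishingIdeal Z).toIdeal := fun H hH =>
      (ProjectiveSpectrum.mem_vanishingIdeal _ _).mpr fun x hx => hH hx rfl
    refine (hZ _ _ (ProjectiveSpectrum.isClosed_zeroLocus _ {F})
      (ProjectiveSpectrum.isClosed_zeroLocus _ {G}) fun x hx => ?_).imp (hmem F) (hmem G)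
    exact (x.isPrime.mem_or_mem ((ProjectiveSpectrum.mem_vanishingIdeal _ _).mp hFG x hx)).imp
      Set.singleton_subset_iff.mpr Set.singleton_subset_iff.mpr

theorem idealAtInfinity_le_of_isPrime (hne : (pointsAtInfinity I).Nonempty)
    {P : Ideal (MvPolynomial (Fin (n + 1)) K)} [hP : P.IsPrime]
    (hJ : (homogenization I).toIdeal ≤ P) (h0 : X 0 ∈ P) : (idealAtInfinity I).toIdeal ≤ P := by
  refine le_trans ?_ (Ideal.toIdeal_homogeneousCore_le (projGrading K n) P)
  by_cases hirr :
      HomogeneousIdeal.irrelevant (projGrading K n) ≤ P.homogeneousCore (projGrading K n)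
  · refine (le_irrelevant_of_ne_top fun h => ?_).trans hirr
    obtain ⟨p, hp⟩ := hne
    exact p.isPrime.ne_top (top_le_iff.mp (h ▸ idealAtInfinity_le_of_mem hp))
  · let p : ProjSpace K n := ⟨P.homogeneousCore (projGrading K n), hP.homogeneousCore, hirr⟩
    refine idealAtInfinity_le_of_mem (p := p) (mem_pointsAtInfinity_iff.mpr ⟨?_, ?_⟩)
    · exact toIdeal_le_of_forall_isHomogeneous fun e F hF hFe =>
        Ideal.mem_homogeneousCore_of_homogeneous_of_mem ⟨e, hFe⟩ (hJ hF)
    · exact Ideal.mem_homogeneousCore_of_homogeneous_of_mem ⟨1, isHomogeneous_X K _⟩ h0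

end ProjectiveClosure

section FunctionField

variable {K : Type*} [Field K] {n : ℕ} (I : Ideal (MvPolynomial (Fin n) K))

/-- The evaluation `F ↦ F(1, x₁, …, xₙ)` at the generic point of the affine variety defined by `I`,
with values in its function field. -/
noncomputable def genericEval :
    MvPolynomial (Fin (n + 1)) K →ₐ[K] FractionRing (MvPolynomial (Fin n) K ⧸ I) :=
  (IsScalarTower.toAlgHom K (MvPolynomial (Fin n) K ⧸ I) _).comp
    ((Ideal.Quotient.mkₐ K I).comp (dehomogenize K n))

variable {I}

theorem genericEval_X_zero : genericEval I (X 0) = 1 := by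
  rw [genericEval, AlgHom.comp_apply, AlgHom.comp_apply, dehomogenize_X_zero, map_one, map_one]

theorem genericEval_eq_zero_iff {F : MvPolynomial (Fin (n + 1)) K} {e : ℕ}
    (hF : F.IsHomogeneous e) : genericEval I F = 0 ↔ F ∈ (homogenization I).toIdeal := by
  rw [mem_homogenization_iff_of_isHomogeneous hF, ← Ideal.Quotient.eq_zero_iff_mem]
  exact map_eq_zero_iff _ (IsFractionRing.injective (MvPolynomial (Fin n) K ⧸ I) _)

theorem genericEval_ne_zero {P : Ideal (MvPolynomial (Fin (n + 1)) K)}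
    (hP : (homogenization I).toIdeal ≤ P) {G : MvPolynomial (Fin (n + 1)) K} {e : ℕ}
    (hG : G.IsHomogeneous e) (hGP : G ∉ P) : genericEval I G ≠ 0 := fun h =>
  hGP (hP ((genericEval_eq_zero_iff hG).mp h))

theorem exists_algebraMap_eq_genericEval (d : MvPolynomial (Fin n) K ⧸ I) :
    ∃ e, ∃ F : MvPolynomial (Fin (n + 1)) K, F.IsHomogeneous e ∧
      algebraMap _ (FractionRing (MvPolynomial (Fin n) K ⧸ I)) d = genericEval I F := by
  obtain ⟨G, rfl⟩ := Ideal.Quotient.mk_surjective d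
  obtain ⟨e, F, hF, rfl⟩ := exists_isHomogeneous_dehomogenize_eq G
  exact ⟨e, F, hF, rfl⟩

variable (I) in
/-- The rational functions `F / G`, with `F` and `G` homogeneous of the same degree and `G ∉ P`: the
local ring of the projective closure along the subvariety defined by `P`, as a subring of the
function field. -/
noncomputable def regularFunctions (P : Ideal (MvPolynomial (Fin (n + 1)) K)) [P.IsPrime] :
    Subalgebra K (FractionRing (MvPolynomial (Fin n) K ⧸ I)) where
  carrier := {z | ∃ e, ∃ F G : MvPolynomial (Fin (n + 1)) K, F.IsHomogeneous e ∧
    G.IsHomogeneous e ∧ G ∉ P ∧ z * genericEval I G = genericEval I F}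
  mul_mem' := by
    rintro z z' ⟨e, F, G, hF, hG, hGP, h⟩ ⟨e', F', G', hF', hG', hGP', h'⟩
    refine ⟨e + e', F * F', G * G', hF.mul hF', hG.mul hG', P.primeCompl.mul_mem hGP hGP', ?_⟩
    rw [map_mul, map_mul, ← h, ← h', mul_mul_mul_comm]
  add_mem' := by
    rintro z z' ⟨e, F, G, hF, hG, hGP, h⟩ ⟨e', F', G', hF', hG', hGP', h'⟩
    refine ⟨e + e', F * G' + G * F', G * G', (hF.mul hG').add (hG.mul hF'), hG.mul hG',
      P.primeCompl.mul_mem hGP hGP', ?_⟩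
    rw [map_mul, map_add, map_mul, map_mul, ← h, ← h']
    ring
  algebraMap_mem' a := by
    refine ⟨0, C a, 1, isHomogeneous_C _ a, isHomogeneous_one _ _, P.primeCompl.one_mem, ?_⟩
    rw [map_one, mul_one, algHom_C]

variable {P Q : Ideal (MvPolynomial (Fin (n + 1)) K)} [P.IsPrime] [Q.IsPrime]

theorem regularFunctions_antitone (hPQ : P ≤ Q) : regularFunctions I Q ≤ regularFunctions I P := by
  rintro z ⟨e, F, G, hF, hG, hGQ, h⟩
  exact ⟨e, F, G, hF, hG, fun hGP => hGQ (hPQ hGP), h⟩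

theorem genericEval_X_notMem_regularFunctions (hP : (homogenization I).toIdeal ≤ P) (h0 : X 0 ∈ P)
    {i : Fin (n + 1)} (hi : X i ∉ P) : genericEval I (X i) ∉ regularFunctions I P := by
  rintro ⟨e, F, G, hF, hG, hGP, h⟩
  have hmem : X i * G - X 0 * F ∈ (homogenization I).toIdeal := by
    refine (genericEval_eq_zero_iff (((isHomogeneous_X K i).mul hG).sub
      ((isHomogeneous_X K 0).mul hF))).mp ?_
    rw [map_sub, map_mul, map_mul, genericEval_X_zero, one_mul, h, sub_self]
  exact P.primeCompl.mul_mem hi hGP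
    ((P.sub_mem_iff_left (P.mul_mem_right F h0)).mp (hP hmem))

variable [I.IsPrime]

theorem div_mem_regularFunctions (hP : (homogenization I).toIdeal ≤ P)
    {F G : MvPolynomial (Fin (n + 1)) K} {e : ℕ} (hF : F.IsHomogeneous e) (hG : G.IsHomogeneous e)
    (hGP : G ∉ P) : genericEval I F / genericEval I G ∈ regularFunctions I P :=
  ⟨e, F, G, hF, hG, hGP, div_mul_cancel₀ _ (genericEval_ne_zero hP hG hGP)⟩

theorem exists_mul_genericEval_eq_genericEval (z : FractionRing (MvPolynomial (Fin n) K ⧸ I)) :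
    ∃ e, ∃ F G : MvPolynomial (Fin (n + 1)) K, F.IsHomogeneous e ∧ G.IsHomogeneous e ∧
      genericEval I G ≠ 0 ∧ z * genericEval I G = genericEval I F := by
  obtain ⟨a, b, hb, rfl⟩ := IsFractionRing.div_surjective (A := MvPolynomial (Fin n) K ⧸ I) z
  obtain ⟨e, F, hF, hFa⟩ := exists_algebraMap_eq_genericEval a
  obtain ⟨k, G, hG, hGb⟩ := exists_algebraMap_eq_genericEval b
  have hb0 : genericEval I G ≠ 0 := hGb ▸ IsFractionRing.to_map_ne_zero_of_mem_nonZeroDivisors hb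
  refine ⟨e + k, F * X 0 ^ k, G * X 0 ^ e, hF.mul (isHomogeneous_X_pow _ _),
    add_comm k e ▸ hG.mul (isHomogeneous_X_pow _ _), ?_, ?_⟩ <;>
  rw [map_mul, map_pow, genericEval_X_zero, one_pow, mul_one]
  · exact hb0
  · rw [map_mul, map_pow, genericEval_X_zero, one_pow, mul_one, hFa, hGb, div_mul_cancel₀ _ hb0]

end FunctionField

section Dimension

variable {K : Type u} [Field K] {n : ℕ} {I : Ideal (MvPolynomial (Fin n) K)} [I.IsPrime]

theorem ringKrullDim_regularFunctions_le {d : ℕ}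
    (hd : ringKrullDim (MvPolynomial (Fin n) K ⧸ I) ≤ d)
    (P : Ideal (MvPolynomial (Fin (n + 1)) K)) [P.IsPrime] :
    ringKrullDim (regularFunctions I P) ≤ d := by
  refine ringKrullDim_le_of_trdeg_le (K := K) ?_
  calc Algebra.trdeg K (regularFunctions I P)
      ≤ Algebra.trdeg K (FractionRing (MvPolynomial (Fin n) K ⧸ I)) :=
        trdeg_le_of_injective (regularFunctions I P).val Subtype.val_injective
    _ = Algebra.trdeg K (MvPolynomial (Fin n) K ⧸ I) := by
        have := IsLocalization.isAlgebraic
          (S := FractionRing (MvPolynomial (Fin n) K ⧸ I))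
          (nonZeroDivisors (MvPolynomial (Fin n) K ⧸ I))
        rw [← trdeg_add_eq K (S := MvPolynomial (Fin n) K ⧸ I),
          trdeg_eq_zero (R := MvPolynomial (Fin n) K ⧸ I), add_zero]
    _ ≤ d := trdeg_le_of_ringKrullDim_le hd

end Dimension

section NonsingularPoint

variable {K : Type*} [Field K] {n : ℕ} {I : Ideal (MvPolynomial (Fin n) K)} [I.IsPrime]
  {p : ProjSpace K n}

theorem genericEval_div_eq_of_val_mul_eq (hp : p ∈ projClosure I) {z : projLocalRing p} {e : ℕ}
    {F G : MvPolynomial (Fin (n + 1)) K} (hG : G.IsHomogeneous e)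
    (hGp : G ∉ p.asHomogeneousIdeal.toIdeal) (h : z.val * algebraMap _ _ G = algebraMap _ _ F) :
    genericEval I z.num / genericEval I z.den = genericEval I F / genericEval I G := by
  have hle := mem_projClosure_iff.mp hp
  have hz : z.num * G = F * z.den := by
    refine IsLocalization.injective (Localization.AtPrime p.asHomogeneousIdeal.toIdeal)
      p.asHomogeneousIdeal.toIdeal.primeCompl_le_nonZeroDivisors ?_
    rw [map_mul, map_mul, ← h, ← z.den_smul_val, Algebra.smul_def]
    ring
  rw [div_eq_div_iff (genericEval_ne_zero hle z.den_mem_deg z.den_mem)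
    (genericEval_ne_zero hle hG hGp), ← map_mul, ← map_mul, hz]

/-- The homomorphism `F / G ↦ F(1, x₁, …, xₙ) / G(1, x₁, …, xₙ)` from the local ring of the
projective space at a point of the projective closure to the function field. -/
noncomputable def projLocalRingToFunctionField (hp : p ∈ projClosure I) :
    projLocalRing p →+* FractionRing (MvPolynomial (Fin n) K ⧸ I) where
  toFun z := genericEval I z.num / genericEval I z.den
  map_one' := by
    rw [genericEval_div_eq_of_val_mul_eq hp (isHomogeneous_one _ _)
      p.asHomogeneousIdeal.toIdeal.one_notMem (F := 1)
      (by rw [HomogeneousLocalization.val_one, one_mul]), map_one, div_one]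
  map_zero' := by
    rw [genericEval_div_eq_of_val_mul_eq hp (isHomogeneous_one _ _)
      p.asHomogeneousIdeal.toIdeal.one_notMem (F := 0)
      (by rw [HomogeneousLocalization.val_zero, zero_mul, map_zero]), map_zero, zero_div]
  map_mul' z w := by
    rw [genericEval_div_eq_of_val_mul_eq hp (z.den_mem_deg.mul w.den_mem_deg)
      (Submonoid.mul_mem _ z.den_mem w.den_mem) (F := z.num * w.num), map_mul, map_mul,
      mul_div_mul_comm]
    rw [HomogeneousLocalization.val_mul, map_mul, map_mul, ← z.den_smul_val, ← w.den_smul_val,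
      Algebra.smul_def, Algebra.smul_def]
    ring
  map_add' z w := by
    have hle := mem_projClosure_iff.mp hp
    rw [genericEval_div_eq_of_val_mul_eq hp (z.den_mem_deg.mul w.den_mem_deg)
      (Submonoid.mul_mem _ z.den_mem w.den_mem) (F := z.num * w.den + z.den * w.num), map_add,
      map_mul, map_mul, map_mul,
      div_add_div _ _ (genericEval_ne_zero hle z.den_mem_deg z.den_mem)
        (genericEval_ne_zero hle w.den_mem_deg w.den_mem)]
    rw [HomogeneousLocalization.val_add, map_add, map_mul, map_mul, map_mul, ← z.den_smul_val,
      ← w.den_smul_val, Algebra.smul_def, Algebra.smul_def]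
    ring

theorem range_projLocalRingToFunctionField (hp : p ∈ projClosure I) :
    (projLocalRingToFunctionField hp).range =
      (regularFunctions I p.asHomogeneousIdeal.toIdeal).toSubring := by
  have hle := mem_projClosure_iff.mp hp
  refine le_antisymm ?_ ?_
  · rintro _ ⟨z, rfl⟩
    exact div_mem_regularFunctions hle z.num_mem_deg z.den_mem_deg z.den_mem
  · rintro z ⟨e, F, G, hF, hG, hGp, h⟩
    refine ⟨HomogeneousLocalization.mk ⟨e, ⟨F, hF⟩, ⟨G, hG⟩, hGp⟩,
      (genericEval_div_eq_of_val_mul_eq hp hG hGp (F := F) ?_).trans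
      (eq_div_of_mul_eq (genericEval_ne_zero hle hG hGp) h).symm⟩
    rw [HomogeneousLocalization.val_mk, mul_comm, ← Algebra.smul_def, Localization.mk_eq_mk',
      IsLocalization.smul_mk']
    exact IsLocalization.mk'_mul_cancel_left _ ⟨_, _⟩

theorem ker_projLocalRingToFunctionField (hp : p ∈ projClosure I) :
    RingHom.ker (projLocalRingToFunctionField hp) = idealAt (projClosure I) p := by
  have hle := mem_projClosure_iff.mp hp
  ext z
  have hden : IsUnit (algebraMap _ (Localization.AtPrime p.asHomogeneousIdeal.toIdeal) z.den) :=
    IsLocalization.map_units _ (⟨z.den, z.den_mem⟩ : p.asHomogeneousIdeal.toIdeal.primeCompl)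
  have hcomap := IsLocalization.under_map_of_isPrime_disjoint
    p.asHomogeneousIdeal.toIdeal.primeCompl
    (Localization.AtPrime p.asHomogeneousIdeal.toIdeal) (homogenization_isPrime (I := I))
    (Set.disjoint_left.mpr fun _ hx hx' => hx (hle hx'))
  calc z ∈ RingHom.ker (projLocalRingToFunctionField hp)
      ↔ genericEval I z.num = 0 :=
        div_eq_zero_iff.trans (or_iff_left (genericEval_ne_zero hle z.den_mem_deg z.den_mem))
    _ ↔ z.num ∈ (homogenization I).toIdeal := genericEval_eq_zero_iff z.num_mem_deg
    _ ↔ algebraMap _ (Localization.AtPrime p.asHomogeneousIdeal.toIdeal) z.num ∈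
          (homogenization I).toIdeal.map (algebraMap _ _) := (SetLike.ext_iff.mp hcomap _).symm
    _ ↔ z ∈ idealAt (projClosure I) p := by
        rw [← z.den_smul_val, Algebra.smul_def, Ideal.unit_mul_mem_iff_mem _ hden,
          ← vanishingIdeal_projClosure]
        rfl

theorem isRegularLocalRing_regularFunctions (h : IsNonsingularPoint (projClosure I) p) :
    IsRegularLocalRing (regularFunctions I p.asHomogeneousIdeal.toIdeal) := by
  have := h.2
  exact IsRegularLocalRing.of_ringEquiv
    ((Ideal.quotEquivOfEq (ker_projLocalRingToFunctionField h.1).symm).trans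
      ((projLocalRingToFunctionField h.1).quotientKerEquivRange.trans
        (RingEquiv.subringCongr (range_projLocalRingToFunctionField h.1))))

end NonsingularPoint

section Valuation

variable {K : Type u} [Field K] {n : ℕ} {I : Ideal (MvPolynomial (Fin n) K)} [I.IsPrime]
  {P : Ideal (MvPolynomial (Fin (n + 1)) K)} [P.IsPrime] {i : Fin (n + 1)}

/-- The homomorphism to the local ring along `P` given by the affine chart `Xᵢ = 1`. -/
noncomputable def chartHom (hP : (homogenization I).toIdeal ≤ P) (hi : X i ∉ P) :
    MvPolynomial (Fin (n + 1)) K →ₐ[K] regularFunctions I P :=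
  aeval fun j => ⟨genericEval I (X j) / genericEval I (X i),
    div_mem_regularFunctions hP (isHomogeneous_X K j) (isHomogeneous_X K i) hi⟩

theorem genericEval_eq_pow_mul_chartHom (hP : (homogenization I).toIdeal ≤ P) (hi : X i ∉ P)
    {F : MvPolynomial (Fin (n + 1)) K} {e : ℕ} (hF : F.IsHomogeneous e) :
    genericEval I F = genericEval I (X i) ^ e * chartHom hP hi F := by
  refine map_eq_pow_mul_of_isHomogeneous (g := (regularFunctions I P).val.comp (chartHom hP hi))
    (fun j => ?_) hF
  rw [AlgHom.comp_apply, chartHom, aeval_X]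
  exact (mul_div_cancel₀ _ (genericEval_ne_zero hP (isHomogeneous_X K i) hi)).symm

theorem chartHom_eq_zero_iff (hP : (homogenization I).toIdeal ≤ P) (hi : X i ∉ P)
    {F : MvPolynomial (Fin (n + 1)) K} {e : ℕ} (hF : F.IsHomogeneous e) :
    chartHom hP hi F = 0 ↔ F ∈ (homogenization I).toIdeal := by
  rw [← genericEval_eq_zero_iff hF, genericEval_eq_pow_mul_chartHom hP hi hF,
    mul_eq_zero_iff_left (pow_ne_zero e (genericEval_ne_zero hP (isHomogeneous_X K i) hi)),
    ZeroMemClass.coe_eq_zero]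

theorem mul_genericEval_eq_iff (hP : (homogenization I).toIdeal ≤ P) (hi : X i ∉ P)
    {F G : MvPolynomial (Fin (n + 1)) K} {e : ℕ} (hF : F.IsHomogeneous e) (hG : G.IsHomogeneous e)
    {z : FractionRing (MvPolynomial (Fin n) K ⧸ I)} :
    z * genericEval I G = genericEval I F ↔ z * chartHom hP hi G = chartHom hP hi F := by
  rw [genericEval_eq_pow_mul_chartHom hP hi hF, genericEval_eq_pow_mul_chartHom hP hi hG,
    mul_left_comm]
  exact mul_right_inj' (pow_ne_zero e (genericEval_ne_zero hP (isHomogeneous_X K i) hi))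

theorem isUnit_chartHom (hP : (homogenization I).toIdeal ≤ P) (hi : X i ∉ P)
    {G : MvPolynomial (Fin (n + 1)) K} {e : ℕ} (hG : G.IsHomogeneous e) (hGP : G ∉ P) :
    IsUnit (chartHom hP hi G) := by
  refine IsUnit.of_mul_eq_one ⟨_, div_mem_regularFunctions hP (isHomogeneous_X_pow i e) hG hGP⟩
    (Subtype.ext ?_)
  change (chartHom hP hi G).1 * (_ / _) = 1
  rw [map_pow, mul_div_assoc', mul_comm, ← genericEval_eq_pow_mul_chartHom hP hi hG,
    div_self (genericEval_ne_zero hP hG hGP)]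

theorem genericEval_X_mul_chartHom_X_zero (hP : (homogenization I).toIdeal ≤ P) (hi : X i ∉ P) :
    genericEval I (X i) * chartHom hP hi (X 0) = 1 := by
  rw [← pow_one (genericEval I (X i)),
    ← genericEval_eq_pow_mul_chartHom hP hi (isHomogeneous_X K 0), genericEval_X_zero]

theorem not_isUnit_chartHom_X_zero (hP : (homogenization I).toIdeal ≤ P) (h0 : X 0 ∈ P)
    (hi : X i ∉ P) : ¬ IsUnit (chartHom hP hi (X 0)) := fun h => by
  obtain ⟨v, hv⟩ := h.exists_right_inv
  have hXv : genericEval I (X i) = v :=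
    left_inv_eq_right_inv (genericEval_X_mul_chartHom_X_zero hP hi) (congrArg Subtype.val hv)
  exact genericEval_X_notMem_regularFunctions hP h0 hi (hXv ▸ v.2)

theorem inv_mem_regularFunctions_idealAtInfinity [(idealAtInfinity I).toIdeal.IsPrime]
    (hne : (pointsAtInfinity I).Nonempty) (hP : (homogenization I).toIdeal ≤ P) (hi : X i ∉ P)
    {Q : Ideal (regularFunctions I P)} [Q.IsPrime] (hQ : chartHom hP hi (X 0) ∈ Q)
    {s : regularFunctions I P} (hs : s ∉ Q) :
    (s : FractionRing (MvPolynomial (Fin n) K ⧸ I))⁻¹ ∈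
      regularFunctions I (idealAtInfinity I).toIdeal := by
  obtain ⟨e, F, G, hF, hG, hGP, h⟩ := s.2
  have hsGF : s * chartHom hP hi G = chartHom hP hi F :=
    Subtype.ext ((mul_genericEval_eq_iff hP hi hF hG).mp h)
  have hle : (idealAtInfinity I).toIdeal ≤ Q.comap (chartHom hP hi) := by
    refine idealAtInfinity_le_of_isPrime hne (toIdeal_le_of_forall_isHomogeneous ?_) hQ
    intro k H hH hHk
    rw [Ideal.mem_comap, (chartHom_eq_zero_iff hP hi hHk).mpr hH]
    exact Q.zero_mem
  have hFQ : chartHom hP hi F ∉ Q := by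
    rwa [← hsGF, Ideal.mul_unit_mem_iff_mem _ (isUnit_chartHom hP hi hG hGP)]
  have hs0 : (s : FractionRing (MvPolynomial (Fin n) K ⧸ I)) ≠ 0 := fun h0 =>
    hs ((Subtype.ext h0 : s = 0) ▸ Q.zero_mem)
  exact ⟨e, G, F, hG, hF, fun hFI => hFQ (hle hFI), by rw [← h, inv_mul_cancel_left₀ hs0]⟩

theorem mem_or_inv_mem_regularFunctions_idealAtInfinity
    (hdim : ringKrullDim (MvPolynomial (Fin n) K ⧸ I) ≤ 2) [(idealAtInfinity I).toIdeal.IsPrime]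
    {p : ProjSpace K n} (hp : p ∈ pointsAtInfinity I) (hns : IsNonsingularPoint (projClosure I) p)
    (z : FractionRing (MvPolynomial (Fin n) K ⧸ I)) :
    z ∈ regularFunctions I (idealAtInfinity I).toIdeal ∨
      z⁻¹ ∈ regularFunctions I (idealAtInfinity I).toIdeal := by
  have hJ := (mem_pointsAtInfinity_iff.mp hp).1
  have h0 := (mem_pointsAtInfinity_iff.mp hp).2
  obtain ⟨i, hi⟩ := exists_X_notMem p
  have := isRegularLocalRing_regularFunctions hns
  obtain ⟨Q, hQ⟩ := Set.nonempty_coe_sort.mp <| Ideal.nonempty_minimalPrimes fun h =>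
    not_isUnit_chartHom_X_zero hJ h0 hi (Ideal.span_singleton_eq_top.mp h)
  have : Q.IsPrime := hQ.1.1
  have h0Q : chartHom hJ hi (X 0) ∈ Q := hQ.1.2 (Ideal.mem_span_singleton_self _)
  obtain ⟨f, rfl⟩ := isPrincipal_of_height_le_one_of_ringKrullDim_le_two
    (ringKrullDim_regularFunctions_le hdim _)
    (Ideal.height_le_one_of_isPrincipal_of_mem_minimalPrimes _ Q hQ)
  have hf0 : f ≠ 0 := by
    rintro rfl
    have hX := genericEval_X_mul_chartHom_X_zero hJ hi
    rw [zero_dvd_iff.mp (Ideal.mem_span_singleton.mp h0Q)] at hX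
    exact zero_ne_one ((mul_zero _).symm.trans hX)
  have hf : Prime f := (Ideal.span_singleton_prime hf0).mp this
  have hfV : ∀ s, ¬ f ∣ s → (s : FractionRing (MvPolynomial (Fin n) K ⧸ I))⁻¹ ∈
      regularFunctions I (idealAtInfinity I).toIdeal := fun s hs =>
    inv_mem_regularFunctions_idealAtInfinity ⟨p, hp⟩ hJ hi h0Q fun hsf =>
      hs (Ideal.mem_span_singleton.mp hsf)
  obtain ⟨e, F, G, hF, hG, hG0, hz⟩ := exists_mul_genericEval_eq_genericEval z
  have hG' : chartHom hJ hi G ≠ 0 := fun h =>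
    hG0 ((genericEval_eq_zero_iff hG).mpr ((chartHom_eq_zero_iff hJ hi hG).mp h))
  exact mem_or_inv_mem_of_prime (L := FractionRing (MvPolynomial (Fin n) K ⧸ I))
    (regularFunctions_antitone (idealAtInfinity_le_of_mem hp)) hf hfV hG'
    ((mul_genericEval_eq_iff hJ hi hF hG).mp hz)

end Valuation

section Rees

theorem isIntegral_map_of_map_le_bot {K A B : Type*} [CommRing K] [CommRing A] [CommRing B]
    [Algebra K A] [Algebra K B] {f : A →ₐ[K] B} {S : Subalgebra K A} (hS : S.map f ≤ ⊥) {a : A}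
    (ha : IsIntegral S a) : IsIntegral K (f a) := by
  have hmem : ∀ x : S, f.comp S.val x ∈ (⊥ : Subalgebra K B) := fun x => hS ⟨x, x.2, rfl⟩
  have : IsIntegral (⊥ : Subalgebra K B) (f a) := ha.map_of_comp_eq
    ((f.comp S.val).codRestrict ⊥ hmem).toRingHom f.toRingHom rfl
  exact isIntegral_trans (A := (⊥ : Subalgebra K B)) _ this

variable {K : Type u} [Field K] {D : Type u} [CommRing D] [Algebra K D] {n : ℕ}
  (φ : MvPolynomial (Fin n) K →ₐ[K] D)

/-- The homomorphism from `K[X₀, …, Xₙ]` onto the Rees algebra in `D[T]` of the degree filtration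
induced by `φ`. The Rees algebra is the homogeneous coordinate ring of the projective closure. -/
noncomputable def reesHom : MvPolynomial (Fin (n + 1)) K →ₐ[K] Polynomial D :=
  aeval (Fin.cons Polynomial.X fun i => Polynomial.X * Polynomial.C (φ (X i)))

variable {φ}

theorem reesHom_X_zero : reesHom φ (X 0) = Polynomial.X := by
  rw [reesHom, aeval_X, Fin.cons_zero]

theorem reesHom_of_isHomogeneous {F : MvPolynomial (Fin (n + 1)) K} {e : ℕ}
    (hF : F.IsHomogeneous e) :
    reesHom φ F = Polynomial.X ^ e * Polynomial.C (φ (dehomogenize K n F)) := by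
  refine map_eq_pow_mul_of_isHomogeneous (f := reesHom φ)
    (g := Polynomial.CAlgHom.comp (φ.comp (dehomogenize K n))) (Fin.cases ?_ fun i => ?_) hF
  · simp [reesHom, dehomogenize_X_zero]
  · simp [reesHom, dehomogenize_X_succ]

theorem C_mul_reesHom_eq {F G : MvPolynomial (Fin (n + 1)) K} {e : ℕ} (hF : F.IsHomogeneous e)
    (hG : G.IsHomogeneous e) {d : D} (h : d * φ (dehomogenize K n G) = φ (dehomogenize K n F)) :
    Polynomial.C d * reesHom φ G = reesHom φ F := by
  rw [reesHom_of_isHomogeneous hF, reesHom_of_isHomogeneous hG, ← h, mul_left_comm,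
    ← Polynomial.C_mul]

theorem coeff_reesHom (F : MvPolynomial (Fin (n + 1)) K) (i : ℕ) :
    (reesHom φ F).coeff i = φ (dehomogenize K n (homogeneousComponent i F)) := by
  conv_lhs => rw [← sum_homogeneousComponent F]
  simp only [map_sum, Polynomial.finsetSum_coeff,
    reesHom_of_isHomogeneous (homogeneousComponent_isHomogeneous _ F), Polynomial.X_pow_mul,
    Polynomial.coeff_C_mul_X_pow, Finset.sum_ite_eq, Finset.mem_range]
  refine ite_eq_left_iff.mpr fun hi => ?_
  rw [homogeneousComponent_eq_zero i F (by omega), map_zero, map_zero]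

theorem ker_reesHom :
    RingHom.ker (reesHom φ) = (homogenization (RingHom.ker φ)).toIdeal := by
  ext F
  have hmem (i : ℕ) : (reesHom φ F).coeff i = 0 ↔
      homogeneousComponent i F ∈ (homogenization (RingHom.ker φ)).toIdeal := by
    rw [coeff_reesHom, ← RingHom.mem_ker,
      mem_homogenization_iff_of_isHomogeneous (homogeneousComponent_isHomogeneous i F)]
  refine ⟨fun h => ?_, fun h => Polynomial.ext fun i =>
    (hmem i).mpr (homogeneousComponent_mem_of_mem (HomogeneousIdeal.isHomogeneous _) h i)⟩
  rw [← sum_homogeneousComponent F]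
  exact Ideal.sum_mem _ fun i _ =>
    (hmem i).mp (by rw [RingHom.mem_ker.mp h, Polynomial.coeff_zero])

theorem exists_reesHom_eq (hφ : Function.Surjective φ) (d : D) :
    ∃ k F, Polynomial.C d * Polynomial.X ^ k = reesHom φ F := by
  obtain ⟨G, rfl⟩ := hφ d
  obtain ⟨k, F, hF, rfl⟩ := exists_isHomogeneous_dehomogenize_eq G
  exact ⟨k, F, ((reesHom_of_isHomogeneous hF).trans Polynomial.X_pow_mul).symm⟩

theorem isIntegral_of_isIntegral_range_reesHom {d : D}
    (hd : IsIntegral (reesHom φ).range (Polynomial.C d)) : IsIntegral K d := by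
  -- Setting `T = 0` maps the Rees algebra to `K` and fixes `d`.
  let ε : Polynomial D →ₐ[K] D := (Polynomial.aeval 0).restrictScalars K
  have hε : ε.comp (reesHom φ) = (Algebra.ofId K D).comp (aeval 0) := by
    ext i
    refine Fin.cases ?_ (fun i => ?_) i <;> simp [ε, reesHom]
  have hle : (reesHom φ).range.map ε ≤ ⊥ := by
    rintro _ ⟨_, ⟨F, rfl⟩, rfl⟩
    exact ⟨_, (AlgHom.congr_fun hε F).symm⟩
  simpa [ε] using isIntegral_map_of_map_le_bot hle hd

variable [IsDomain D]

theorem comap_eq_of_height_le_one {Q : Ideal (MvPolynomial (Fin (n + 1)) K)} [Q.IsPrime]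
    (hQ : RingHom.ker (reesHom φ) ≤ Q) (h0 : X 0 ∈ Q) {P : Ideal (reesHom φ).range} [P.IsPrime]
    (hP : P.height ≤ 1) (hQP : Q ≤ P.comap (reesHom φ).rangeRestrict) :
    P.comap (reesHom φ).rangeRestrict = Q := by
  let ρ := (reesHom φ).rangeRestrict
  have hρ : Function.Surjective ρ := (reesHom φ).rangeRestrict_surjective
  have hker : RingHom.ker ρ = RingHom.ker (reesHom φ) := (reesHom φ).ker_rangeRestrict
  have hQ' : (Q.map ρ).IsPrime := Ideal.map_isPrime_of_surjective hρ (hker ▸ hQ)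
  have hcomap : (Q.map ρ).comap ρ = Q :=
    (Ideal.comap_map_of_surjective' ρ hρ Q).trans (sup_eq_left.mpr (hker ▸ hQ))
  rw [← hcomap]
  congr 1
  by_contra hne
  have hbot := eq_bot_of_lt_of_height_le_one hP hQ'
    (lt_of_le_of_ne (Ideal.map_le_iff_le_comap.mpr hQP) (Ne.symm hne))
  have h0' : ρ (X 0) = 0 := (Submodule.mem_bot _).mp (hbot ▸ Ideal.mem_map_of_mem ρ h0)
  exact Polynomial.X_ne_zero (reesHom_X_zero.symm.trans (congrArg Subtype.val h0'))

theorem isIntegral_of_C_mul_reesHom_eq (hφ : Function.Surjective φ)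
    {Q : Ideal (MvPolynomial (Fin (n + 1)) K)} [Q.IsPrime] (hQ : RingHom.ker (reesHom φ) ≤ Q)
    (h0 : X 0 ∈ Q) (hmin : ∀ P : Ideal (MvPolynomial (Fin (n + 1)) K), P.IsPrime →
      RingHom.ker (reesHom φ) ≤ P → X 0 ∈ P → Q ≤ P)
    {d : D} {F G : MvPolynomial (Fin (n + 1)) K} (hG : G ∉ Q)
    (hd : Polynomial.C d * reesHom φ G = reesHom φ F) : IsIntegral K d := by
  let S := (reesHom φ).range
  let L := FractionRing (Polynomial D)
  have hinj : Function.Injective (algebraMap (Polynomial D) L) := IsFractionRing.injective _ _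
  have : Algebra.FiniteType K S :=
    .of_surjective _ (reesHom φ).rangeRestrict_surjective
  have : FaithfulSMul S L := (faithfulSMul_iff_algebraMap_injective _ _).mpr
    (hinj.comp Subtype.val_injective)
  refine isIntegral_of_isIntegral_range_reesHom ((isIntegral_algebraMap_iff hinj).mp
    (isIntegral_of_forall_height_le_one K (S := S) fun P _ hP => ?_))
  suffices h : ∃ F G, G ∉ P.comap (reesHom φ).rangeRestrict ∧
      Polynomial.C d * reesHom φ G = reesHom φ F by
    obtain ⟨F, G, hG, h⟩ := h
    exact ⟨_, hG, (reesHom φ).rangeRestrict F,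
      (map_mul (algebraMap _ L) _ _).symm.trans (congrArg _ h)⟩
  by_cases h0P : X 0 ∈ P.comap (reesHom φ).rangeRestrict
  · refine ⟨F, G, ?_, hd⟩
    have hker : RingHom.ker (reesHom φ) ≤ P.comap (reesHom φ).rangeRestrict :=
      (reesHom φ).ker_rangeRestrict ▸ Ideal.ker_le_comap _
    rwa [comap_eq_of_height_le_one hQ h0 hP (hmin _ inferInstance hker h0P)]
  · obtain ⟨k, H, hH⟩ := exists_reesHom_eq hφ d
    refine ⟨H, X 0 ^ k, fun h => h0P (Ideal.IsPrime.mem_of_pow_mem inferInstance k h), ?_⟩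
    rw [map_pow, reesHom_X_zero, hH]

end Rees

theorem one_le_ringKrullDim_of_not_isField {R : Type*} [CommRing R] [IsDomain R]
    (h : ¬ IsField R) : 1 ≤ ringKrullDim R := by
  obtain ⟨m, hm⟩ := Ideal.exists_maximal R
  have hlt : ⊥ < m := bot_lt_iff_ne_bot.mpr (Ring.ne_bot_of_isMaximal_of_not_isField hm h)
  exact Order.one_le_krullDim_iff.mpr
    ⟨⊥, ⟨m, hm.isPrime⟩, (PrimeSpectrum.asIdeal_lt_asIdeal _ _).mp hlt⟩

theorem map_integralClosure_eq_range {R D L : Type*} [CommRing R] [Nontrivial R] [CommRing D]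
    [CommRing L] [Algebra R D] [Algebra D L] [Algebra R L] [IsScalarTower R D L]
    (hR : ∀ d : D, IsAlgebraic R d → d ∈ (algebraMap R D).range) :
    (integralClosure R D).toSubring.map (algebraMap D L) = (algebraMap R L).range := by
  have hbot : integralClosure R D = ⊥ := eq_bot_iff.mpr fun d hd => hR d (IsIntegral.isAlgebraic hd)
  rw [hbot, IsScalarTower.algebraMap_eq R D, ← RingHom.map_range]
  rfl

section ReciprocalComplement

variable {D : Type*} [CommRing D] [IsDomain D]

theorem inv_algebraMap_mem_reciprocalComplement {d : D} (hd : d ≠ 0) :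
    (algebraMap D (FractionRing D) d)⁻¹ ∈ reciprocalComplement D :=
  Subring.subset_closure ⟨d, hd, rfl⟩

theorem algebraMap_mem_reciprocalComplement_of_isUnit {d : D} (hd : IsUnit d) :
    algebraMap D (FractionRing D) d ∈ reciprocalComplement D := by
  obtain ⟨u, rfl⟩ := hd
  have h : algebraMap D (FractionRing D) u * algebraMap D (FractionRing D) ↑u⁻¹ = 1 := by
    rw [← map_mul, Units.mul_inv, map_one]
  rw [eq_inv_of_mul_eq_one_left h]
  exact inv_algebraMap_mem_reciprocalComplement u⁻¹.ne_zero

theorem one_le_ringKrullDim_reciprocalComplement {d : D}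
    (hd : algebraMap D (FractionRing D) d ∉ reciprocalComplement D) :
    1 ≤ ringKrullDim (reciprocalComplement D) := by
  refine one_le_ringKrullDim_of_not_isField fun hfield => ?_
  have hd0 : d ≠ 0 := by
    rintro rfl
    exact hd (map_zero (algebraMap D (FractionRing D)) ▸ zero_mem _)
  have hd0' : algebraMap D (FractionRing D) d ≠ 0 :=
    (map_ne_zero_iff _ (IsFractionRing.injective D _)).mpr hd0
  obtain ⟨y, hy⟩ := hfield.mul_inv_cancel
    (a := ⟨_, inv_algebraMap_mem_reciprocalComplement hd0⟩)
    fun h => inv_ne_zero hd0' (congrArg Subtype.val h)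
  rw [← inv_inv (algebraMap D _ d), inv_eq_of_mul_eq_one_right (congrArg Subtype.val hy)] at hd
  exact hd y.2

variable {K : Type*} [Field K] [Algebra K D]

theorem reciprocalComplement_le_of_valuation {V : Subalgebra K (FractionRing D)}
    (hV : ∀ z, z ∈ V ∨ z⁻¹ ∈ V)
    (hint : ∀ d : D, algebraMap D (FractionRing D) d ∈ V → IsIntegral K d) :
    reciprocalComplement D ≤ V.toSubring := by
  refine Subring.closure_le.mpr ?_
  rintro _ ⟨d, -, rfl⟩
  refine (hV _).elim (fun hd => ?_) id
  have hint : IsIntegral K (algebraMap D (FractionRing D) d) := (hint d hd).algebraMap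
  exact Algebra.adjoin_le (Set.singleton_subset_iff.mpr hd) hint.inv_mem_adjoin

theorem range_inf_reciprocalComplement_eq {V : Subalgebra K (FractionRing D)}
    (hV : ∀ z, z ∈ V ∨ z⁻¹ ∈ V)
    (hint : ∀ d : D, algebraMap D (FractionRing D) d ∈ V → IsIntegral K d) :
    (algebraMap D (FractionRing D)).range ⊓ reciprocalComplement D =
      (integralClosure K D).toSubring.map (algebraMap D (FractionRing D)) := by
  ext z
  constructor
  · rintro ⟨⟨d, rfl⟩, hd⟩
    exact ⟨d, hint d (reciprocalComplement_le_of_valuation hV hint hd), rfl⟩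
  · rintro ⟨d, hd, rfl⟩
    refine ⟨⟨d, rfl⟩, ?_⟩
    obtain rfl | hd0 := eq_or_ne d 0
    · exact map_zero (algebraMap D (FractionRing D)) ▸ zero_mem _
    · exact algebraMap_mem_reciprocalComplement_of_isUnit (IsIntegral.isUnit hd hd0)

end ReciprocalComplement

section CoordinateRing

variable {K : Type*} [Field K] {n : ℕ} {I : Ideal (MvPolynomial (Fin n) K)} [I.IsPrime]

theorem isIntegral_of_algebraMap_mem_regularFunctions (hne : (pointsAtInfinity I).Nonempty)
    [(idealAtInfinity I).toIdeal.IsPrime] {d : MvPolynomial (Fin n) K ⧸ I}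
    (hd : algebraMap _ (FractionRing (MvPolynomial (Fin n) K ⧸ I)) d ∈
      regularFunctions I (idealAtInfinity I).toIdeal) : IsIntegral K d := by
  obtain ⟨e, F, G, hF, hG, hGP, h⟩ := hd
  have hker : RingHom.ker (reesHom (Ideal.Quotient.mkₐ K I)) = (homogenization I).toIdeal := by
    have hI : RingHom.ker (Ideal.Quotient.mkₐ K I) = I := Ideal.Quotient.mkₐ_ker K I
    rw [ker_reesHom, hI]
  have hmk : d * Ideal.Quotient.mkₐ K I (dehomogenize K n G) =
      Ideal.Quotient.mkₐ K I (dehomogenize K n F) :=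
    IsFractionRing.injective _ (FractionRing (MvPolynomial (Fin n) K ⧸ I))
      ((map_mul _ _ _).trans h)
  exact isIntegral_of_C_mul_reesHom_eq Ideal.Quotient.mk_surjective
    (hker ▸ homogenization_le_idealAtInfinity) X_zero_mem_idealAtInfinity
    (fun P _ hP h0 => idealAtInfinity_le_of_isPrime hne (hker ▸ hP) h0) hGP
    (C_mul_reesHom_eq hF hG hmk)

theorem exists_algebraMap_notMem_regularFunctions [(idealAtInfinity I).toIdeal.IsPrime]
    (hne : (pointsAtInfinity I).Nonempty) :
    ∃ d : MvPolynomial (Fin n) K ⧸ I,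
      algebraMap _ (FractionRing (MvPolynomial (Fin n) K ⧸ I)) d ∉
        regularFunctions I (idealAtInfinity I).toIdeal := by
  obtain ⟨p, hp⟩ := hne
  obtain ⟨i, hi⟩ := exists_X_notMem p
  exact ⟨_, genericEval_X_notMem_regularFunctions homogenization_le_idealAtInfinity
    X_zero_mem_idealAtInfinity fun h => hi (idealAtInfinity_le_of_mem hp h)⟩

end CoordinateRing

theorem proposition3p14_general {K : Type*} [Field K] {n : ℕ}
    (I : Ideal (MvPolynomial (Fin n) K)) [I.IsPrime]
    (hdim : ringKrullDim (MvPolynomial (Fin n) K ⧸ I) ≤ 2)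
    (hirr : IsIrreducible (pointsAtInfinity I))
    (hns : ∃ p ∈ pointsAtInfinity I, IsNonsingularPoint (projClosure I) p) :
    (algebraMap (MvPolynomial (Fin n) K ⧸ I)
          (FractionRing (MvPolynomial (Fin n) K ⧸ I))).range ⊓
        reciprocalComplement (MvPolynomial (Fin n) K ⧸ I) =
      (integralClosure K (MvPolynomial (Fin n) K ⧸ I)).toSubring.map (algebraMap _ _) ∧
      1 ≤ ringKrullDim (reciprocalComplement (MvPolynomial (Fin n) K ⧸ I)) := by
  obtain ⟨p, hp, hns⟩ := hns
  have : (idealAtInfinity I).toIdeal.IsPrime := vanishingIdeal_isPrime_of_isIrreducible hirr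
  have hV := mem_or_inv_mem_regularFunctions_idealAtInfinity hdim hp hns
  have hint (d : MvPolynomial (Fin n) K ⧸ I) :=
    isIntegral_of_algebraMap_mem_regularFunctions (d := d) hirr.nonempty
  obtain ⟨d, hd⟩ := exists_algebraMap_notMem_regularFunctions hirr.nonempty
  exact ⟨range_inf_reciprocalComplement_eq hV hint, one_le_ringKrullDim_reciprocalComplement
    fun h => hd (reciprocalComplement_le_of_valuation hV hint h)⟩

theorem proposition3p14 {K : Type*} [Field K] {n : ℕ}
    (I : Ideal (MvPolynomial (Fin n) K)) [I.IsPrime]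
    (hdim : ringKrullDim (MvPolynomial (Fin n) K ⧸ I) = 2)
    (hirr : IsIrreducible (pointsAtInfinity I))
    (hns : ∃ p ∈ pointsAtInfinity I, IsNonsingularPoint (projClosure I) p) :
    ((∀ f : MvPolynomial (Fin n) K ⧸ I, IsAlgebraic K f →
          f ∈ (algebraMap K (MvPolynomial (Fin n) K ⧸ I)).range) →
        (algebraMap (MvPolynomial (Fin n) K ⧸ I)
            (FractionRing (MvPolynomial (Fin n) K ⧸ I))).range ⊓
          reciprocalComplement (MvPolynomial (Fin n) K ⧸ I) =
        (algebraMap K (FractionRing (MvPolynomial (Fin n) K ⧸ I))).range) ∧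
      1 ≤ ringKrullDim (reciprocalComplement (MvPolynomial (Fin n) K ⧸ I)) := by
  obtain ⟨ha, hb⟩ := proposition3p14_general I hdim.le hirr hns
  exact ⟨fun hK => ha.trans (map_integralClosure_eq_range hK), hb⟩
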